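/- Let $R$ be the ring of integers of a number field and $R^\times = R\setminus\{0\}$. Let $P = R\rtimes R^\times$ be the $ax+b$-semigroup, i.e. the set of pairs $(b,a)$, $b\in R$, $a\in R^\times$, with $(b,a)(d,c)=(b+ad,ac)$. It is left cancellative. For a left cancellative monoid $P$, let $\mathcal J_P$ be the smallest family of right ideals of $P$ that contains $P$ and $\emptyset$ and is closed under $X\mapsto pX$, $X\mapsto p^{-1}X=\{y\in P: py\in X\}$ ($p\in P$) and finite intersections. The full semigroup C*-algebra $C^*(P)$ is the universal (unital) C*-algebra generated by isometries $v_p$ ($p\in P$) and projections $e_X$ ($X\in\mathcal J_P$) subject to $v_{pq}=v_pv_q$, $v_pe_Xv_p^*=e_{pX}$, $e_P=1$, $e_\emptyset=0$, $e_{X\cap Y}=e_Xe_Y$. The Toeplitz algebra $\mathfrak T[R]$ is the universal (unital) C*-algebra generated by unitaries $u^b$ ($b\in R$), isometries $s_a$ ($a\in R^\times$) and projections $e_I$ ($I$ a nonzero ideal of $R$) subject to $u^0=1$, $u^bs_au^ds_c=u^{b+ad}s_{ac}$, $e_{I\cap J}=e_Ie_J$, $e_R=1$, $s_ae_Is_a^*=e_{aI}$,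 $u^be_Iu^{-b}=e_I$ if $b\in I$, and $u^be_Iu^{-b}\,e_I=0$ if $b\notin I$. Then the constructible right ideals of $P=R\rtimes R^\times$ are exactly $\emptyset$ and the sets $(b+I)\times I^\times$ with $b\in R$ and $I$ a nonzero ideal of $R$, where $I^\times=I\setminus\{0\}$; and there is a unique $*$-isomorphism $\varphi\colon C^*(R\rtimes R^\times)\to\mathfrak T[R]$ such that for all $b \in R$, $a \in R^\times$ and all nonzero ideals $I$ of $R$ $$\varphi(v_{(b,a)})=u^bs_a,\qquad \varphi(e_{(b+I)\times I^\times})=u^be_Iu^{-b},\qquad \varphi(e_\emptyset)=0,$$ $$\varphi^{-1}(u^b)=v_{(b,1)},\qquad \varphi^{-1}(s_a)=v_{(0,a)},\qquad \varphi^{-1}(e_I)=e_{I\times I^\times}.$$ -/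

import Mathlib

open scoped ENNReal nonZeroDivisors NumberField

universe u v

noncomputable section

/-! ### Universal unital C*-algebras given by generators and relations

A unital C*-algebra is Mathlib's `CStarAlgebra`. The universal algebra is the closed unital
`*`-subalgebra generated by the tuples of generators in the `ℓ^∞`-product of all models of the
relations. A C*-algebra generated by a family indexed by a type in `Type u` has, up to isomorphism,
its underlying set in `Type u`, so letting the models range over `Type u` loses nothing. -/

/-- Relations on a family of elements, indexed by `G`, of a unital C*-algebra, which force each
of these elements to have norm at most one. -/
structure CStarRelations (G : Type u) where
  Holds : ∀ (A : Type u) [CStarAlgebra A], (G → A) → Prop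
  norm_le : ∀ (A : Type u) [CStarAlgebra A] (x : G → A), Holds A x → ∀ g, ‖x g‖ ≤ 1

namespace CStarRelations

variable {G : Type u}

/-- A nonzero unital C*-algebra with a family of elements that satisfies the relations.
(Zero algebras contribute nothing to the product of all models.) -/
structure Model (R : CStarRelations G) where
  carrier : Type u
  [cstar : CStarAlgebra carrier]
  [nontriv : Nontrivial carrier]
  gen : G → carrier
  holds : R.Holds carrier gen

attribute [instance] Model.cstar Model.nontriv

/-- The C*-algebra of bounded families `(x_m)`, where `m` runs through all models and `x_m` is in
the algebra of `m`, with the supremum norm. -/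
abbrev ModelProduct (R : CStarRelations G) : Type (u + 1) :=
  lp (fun m : Model R => m.carrier) ∞

instance (R : CStarRelations G) : CStarAlgebra (ModelProduct R) where

/-- The family of the `g`-th generators of all models. -/
def tuple (R : CStarRelations G) (g : G) : ModelProduct R :=
  ⟨fun m => m.gen g, memℓp_infty ⟨1, by
    rintro _ ⟨m, rfl⟩
    exact R.norm_le m.carrier m.gen m.holds g⟩⟩

/-- The closed unital `*`-subalgebra of the product which the tuples generate. -/
def subalgebra (R : CStarRelations G) : StarSubalgebra ℂ (ModelProduct R) :=
  (StarAlgebra.adjoin ℂ (Set.range R.tuple)).topologicalClosure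

instance (R : CStarRelations G) : IsClosed (R.subalgebra : Set (ModelProduct R)) :=
  StarSubalgebra.isClosed_topologicalClosure _

/-- The universal unital C*-algebra generated by a family subject to the relations `R`. -/
def Universal (R : CStarRelations G) : Type (u + 1) := R.subalgebra

instance (R : CStarRelations G) : CStarAlgebra R.Universal :=
  inferInstanceAs (CStarAlgebra R.subalgebra)

/-- The canonical generators of the universal C*-algebra. -/
def generator (R : CStarRelations G) (g : G) : R.Universal :=
  ⟨R.tuple g, StarSubalgebra.le_topologicalClosure _
    (StarAlgebra.subset_adjoin ℂ _ (Set.mem_range_self g))⟩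

end CStarRelations

theorem norm_le_one_of_isometry {A : Type*} [CStarAlgebra A] {x : A} (h : star x * x = 1) :
    ‖x‖ ≤ 1 := by
  have h1 : ‖x‖ * ‖x‖ = ‖(1 : A)‖ := by rw [← CStarRing.norm_star_mul_self, h]
  have h2 : ‖(1 : A)‖ ≤ 1 := by
    have h3 : ‖(1 : A)‖ * ‖(1 : A)‖ = ‖(1 : A)‖ := by
      rw [← CStarRing.norm_star_mul_self, star_one, one_mul]
    nlinarith [norm_nonneg (1 : A)]
  nlinarith [norm_nonneg x]

/-! ### Full semigroup C*-algebras -/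

section Semigroup

variable (P : Type u) [LeftCancelMonoid P]

/-- Membership in the smallest family of subsets of `P` which contains `P` and `∅` and is closed
under `X ↦ pX = {px | x ∈ X}`, `X ↦ p⁻¹X = {y | py ∈ X}` and finite intersections. All these
operations preserve right ideals, so this is also the smallest such family of right ideals. -/
inductive IsConstructible : Set P → Prop
  | univ : IsConstructible Set.univ
  | empty : IsConstructible ∅
  | image (p : P) (X : Set P) : IsConstructible X → IsConstructible ((fun x => p * x) '' X)
  | preimage (p : P) (X : Set P) : IsConstructible X → IsConstructible ((fun y => p * y) ⁻¹' X)
  | inter (X Y : Set P) : IsConstructible X → IsConstructible Y → IsConstructible (X ∩ Y)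

/-- The family of constructible right ideals of `P`. -/
def ConstructibleIdeal : Type u := {X : Set P // IsConstructible P X}

namespace ConstructibleIdeal

variable {P}

/-- The whole semigroup, as a constructible right ideal. -/
def whole : ConstructibleIdeal P := ⟨Set.univ, .univ⟩

/-- The empty constructible right ideal. -/
def empty : ConstructibleIdeal P := ⟨∅, .empty⟩

/-- The constructible right ideal `pX`. -/
def leftMul (p : P) (X : ConstructibleIdeal P) : ConstructibleIdeal P :=
  ⟨(fun x => p * x) '' X.1, .image p X.1 X.2⟩

/-- The constructible right ideal `X ∩ Y`. -/
def inter (X Y : ConstructibleIdeal P) : ConstructibleIdeal P :=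
  ⟨X.1 ∩ Y.1, .inter X.1 Y.1 X.2 Y.2⟩

end ConstructibleIdeal

variable {P} in
/-- Isometries `v p` and projections `e X` that satisfy the defining relations of `C*(P)`. -/
structure IsSemigroupFamily {A : Type v} [CStarAlgebra A] (v : P → A)
    (e : ConstructibleIdeal P → A) : Prop where
  isometry : ∀ p, star (v p) * v p = 1
  projection : ∀ X, IsStarProjection (e X)
  v_mul : ∀ p q, v (p * q) = v p * v q
  v_e_star : ∀ p X, v p * e X * star (v p) = e (.leftMul p X)
  e_whole : e .whole = 1
  e_empty : e .empty = 0
  e_inter : ∀ X Y, e (.inter X Y) = e X * e Y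

/-- The relations that define `C*(P)`. -/
def semigroupRelations : CStarRelations (P ⊕ ConstructibleIdeal P) where
  Holds _ _ x := IsSemigroupFamily (fun p => x (.inl p)) (fun X => x (.inr X))
  norm_le _ _ _ h g := match g with
    | .inl p => norm_le_one_of_isometry (h.isometry p)
    | .inr X => (h.projection X).norm_le

/-- The full semigroup C*-algebra `C*(P)`. -/
def FullSemigroupCStar : Type (u + 1) := (semigroupRelations P).Universal

instance : CStarAlgebra (FullSemigroupCStar P) :=
  inferInstanceAs (CStarAlgebra (semigroupRelations P).Universal)

namespace FullSemigroupCStar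

variable {P}

/-- The canonical isometries of `C*(P)`. -/
def v (p : P) : FullSemigroupCStar P := (semigroupRelations P).generator (.inl p)

/-- The canonical projections of `C*(P)`. -/
def e (X : ConstructibleIdeal P) : FullSemigroupCStar P :=
  (semigroupRelations P).generator (.inr X)

end FullSemigroupCStar

end Semigroup

/-! ### The `ax+b`-semigroup of an integral domain -/

section Domain

variable (R : Type u) [CommRing R]

/-- The `ax+b`-semigroup `R ⋊ R^×`: pairs `(b, a)` with `b` in `R` and `a` in `R^× = R \ {0}`.
In a domain, `R⁰ = nonZeroDivisors R` is the multiplicative monoid of the nonzero elements. -/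
@[ext]
structure AxbSemigroup where
  b : R
  a : R⁰

variable {R}

instance : Mul (AxbSemigroup R) := ⟨fun x y => ⟨x.b + x.a * y.b, x.a * y.a⟩⟩

instance : One (AxbSemigroup R) := ⟨⟨0, 1⟩⟩

theorem AxbSemigroup.mul_def (x y : AxbSemigroup R) :
    x * y = ⟨x.b + x.a * y.b, x.a * y.a⟩ := rfl

theorem AxbSemigroup.one_def : (1 : AxbSemigroup R) = ⟨0, 1⟩ := rfl

variable [IsDomain R]

instance : LeftCancelMonoid (AxbSemigroup R) where
  mul_assoc x y z := by
    ext
    · simp only [AxbSemigroup.mul_def, Submonoid.coe_mul]; ring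
    · simp only [AxbSemigroup.mul_def, mul_assoc]
  one_mul x := by ext <;> simp [AxbSemigroup.mul_def, AxbSemigroup.one_def]
  mul_one x := by ext <;> simp [AxbSemigroup.mul_def, AxbSemigroup.one_def]
  mul_left_cancel x y z h := by
    have hx : (x.a : R) ≠ 0 := nonZeroDivisors.ne_zero x.a.2
    simp only [AxbSemigroup.mul_def, AxbSemigroup.mk.injEq] at h
    ext
    · exact mul_left_cancel₀ hx (add_left_cancel h.1)
    · exact mul_left_cancel₀ hx (by simpa using congrArg Subtype.val h.2)

variable (R) in
/-- The nonzero ideals of `R`. -/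
def NonzeroIdeal : Type u := {I : Ideal R // I ≠ ⊥}

namespace NonzeroIdeal

/-- The ideal `R`. -/
def whole : NonzeroIdeal R := ⟨⊤, top_ne_bot⟩

/-- The ideal `I ∩ J`. -/
def inter (I J : NonzeroIdeal R) : NonzeroIdeal R :=
  ⟨I.1 ⊓ J.1, fun h => by
    have h2 : I.1 * J.1 = ⊥ := le_bot_iff.mp (Ideal.mul_le_inf.trans h.le)
    rcases Ideal.mul_eq_bot.mp h2 with h3 | h3
    · exact I.2 h3
    · exact J.2 h3⟩

/-- The ideal `aI`, for a nonzero `a`. -/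
def leftMul (a : R⁰) (I : NonzeroIdeal R) : NonzeroIdeal R :=
  ⟨Ideal.span {(a : R)} * I.1, fun h => by
    rcases Ideal.mul_eq_bot.mp h with h3 | h3
    · exact nonZeroDivisors.ne_zero a.2 (Ideal.span_singleton_eq_bot.mp h3)
    · exact I.2 h3⟩

/-- The subset `(b + I) × I^×` of `R ⋊ R^×`, where `I^× = I \ {0}`. -/
def cosetProd (b : R) (I : NonzeroIdeal R) : Set (AxbSemigroup R) :=
  {x | x.b - b ∈ I.1 ∧ (x.a : R) ∈ I.1}

end NonzeroIdeal

/-! ### The Toeplitz algebra -/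

/-- Unitaries `u b = u^b`, isometries `s a` and projections `e I` that satisfy the defining
relations of `𝔗[R]`. The relation `u 0 = 1` is the usual meaning of the exponential notation. -/
structure IsToeplitzFamily {A : Type v} [CStarAlgebra A] (u : R → A) (s : R⁰ → A)
    (e : NonzeroIdeal R → A) : Prop where
  u_unitary : ∀ b, u b ∈ unitary A
  s_isometry : ∀ a, star (s a) * s a = 1
  e_projection : ∀ I, IsStarProjection (e I)
  u_zero : u 0 = 1
  u_s_mul : ∀ (b d : R) (a c : R⁰), u b * s a * (u d * s c) = u (b + a * d) * s (a * c)
  e_inter : ∀ I J, e (.inter I J) = e I * e J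
  e_whole : e .whole = 1
  s_e_star : ∀ a I, s a * e I * star (s a) = e (.leftMul a I)
  u_e_mem : ∀ (b : R) (I : NonzeroIdeal R), b ∈ I.1 → u b * e I * u (-b) = e I
  u_e_notMem : ∀ (b : R) (I : NonzeroIdeal R), b ∉ I.1 → u b * e I * u (-b) * e I = 0

variable (R)

/-- The relations that define `𝔗[R]`. -/
def toeplitzRelations : CStarRelations (R ⊕ R⁰ ⊕ NonzeroIdeal R) where
  Holds _ _ x := IsToeplitzFamily (fun b => x (.inl b)) (fun a => x (.inr (.inl a)))
    (fun I => x (.inr (.inr I)))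
  norm_le _ _ _ h g := match g with
    | .inl b => norm_le_one_of_isometry (Unitary.mem_iff.mp (h.u_unitary b)).1
    | .inr (.inl a) => norm_le_one_of_isometry (h.s_isometry a)
    | .inr (.inr I) => (h.e_projection I).norm_le

/-- The Toeplitz algebra `𝔗[R]`. -/
def ToeplitzAlgebra : Type (u + 1) := (toeplitzRelations R).Universal

instance : CStarAlgebra (ToeplitzAlgebra R) :=
  inferInstanceAs (CStarAlgebra (toeplitzRelations R).Universal)

namespace ToeplitzAlgebra

variable {R}

/-- The canonical unitaries `u^b` of `𝔗[R]`. -/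
def u (b : R) : ToeplitzAlgebra R := (toeplitzRelations R).generator (.inl b)

/-- The canonical isometries `s_a` of `𝔗[R]`. -/
def s (a : R⁰) : ToeplitzAlgebra R := (toeplitzRelations R).generator (.inr (.inl a))

/-- The canonical projections `e_I` of `𝔗[R]`. -/
def e (I : NonzeroIdeal R) : ToeplitzAlgebra R :=
  (toeplitzRelations R).generator (.inr (.inr I))

end ToeplitzAlgebra

end Domain

end

/-! Each family of generators can be written in terms of the other so that the defining relations
carry over. The resulting homomorphisms are mutually inverse because they are so on generators.

From `𝔗[R]` to `C*(P)`, the relations of `𝔗[R]` follow from set identities in `P`: translating `I ×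
I^×` by `(b,1)` gives the same set if `b ∈ I` and a disjoint one otherwise. In the other direction
the projection `u^b e_I u^{-b}` must depend only on the set `(b + I) × I^×`
(`conj_eq_of_cosetProd_eq`), and products must match intersections. Two cosets `b + I`, `c + J`
either share a point `x`, to which both base points can be moved, or satisfy `b - c ∉ I + J`. In the
latter case the product vanishes, since `e_I` and `e_J` lie below `e_{I+J}`
(`conj_mul_conj_eq_zero`).

All this needs every `(b + I) × I^×` to be constructible. This is where the Dedekind property
enters: `I` is an ideal quotient of principal ideals (`exists_mem_iff_dvd_mul`). -/

open scoped CStarAlgebra in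
theorem StarAlgHom.continuous_of_cstarAlgebra {A B : Type*} [CStarAlgebra A] [CStarAlgebra B]
    (f : A →⋆ₐ[ℂ] B) : Continuous f := map_continuous f

/-! ### Universal property of the universal C*-algebra -/

namespace CStarRelations

variable {G H : Type u} {R : CStarRelations G} {S : CStarRelations H}

/-- The projection of the universal C*-algebra onto a model. -/
noncomputable def eval (m : Model R) : R.Universal →⋆ₐ[ℂ] m.carrier where
  toFun x := x.1.1 m
  map_one' := rfl
  map_mul' _ _ := rfl
  map_zero' := rfl
  map_add' _ _ := rfl
  commutes' _ := rfl
  map_star' _ := rfl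

theorem Universal.ext_eval {x y : R.Universal} (h : ∀ m, eval m x = eval m y) : x = y :=
  Subtype.ext (Subtype.ext (funext h))

/-- The generators generate a dense `*`-subalgebra, and `*`-homomorphisms of C*-algebras are
continuous. -/
theorem Universal.hom_ext {B : Type*} [CStarAlgebra B] {f g : R.Universal →⋆ₐ[ℂ] B}
    (h : ∀ i, f (R.generator i) = g (R.generator i)) : f = g := by
  refine StarAlgHom.ext_topologicalClosure (S := StarAlgebra.adjoin ℂ (Set.range R.tuple))
    f.continuous_of_cstarAlgebra g.continuous_of_cstarAlgebra ?_
  refine StarAlgHom.ext_adjoin ?_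
  rintro ⟨_, _⟩ ⟨i, rfl⟩
  exact h i

/-- The model of `R` obtained from a model of `S` through a substitution of generators. -/
noncomputable def Model.subst (y : G → S.Universal)
    (hy : ∀ m : Model S, R.Holds m.carrier fun g => eval m (y g)) (m : Model S) : Model R where
  carrier := m.carrier
  gen g := eval m (y g)
  holds := hy m

/-- Restriction of a bounded family on the models of `R` to the models that come from `S`. -/
noncomputable def reindex (y : G → S.Universal)
    (hy : ∀ m : Model S, R.Holds m.carrier fun g => eval m (y g)) :
    ModelProduct R →⋆ₐ[ℂ] ModelProduct S where
  toFun x := ⟨fun m => x.1 (m.subst y hy), memℓp_infty ⟨‖x‖, by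
    rintro _ ⟨m, rfl⟩
    exact lp.norm_apply_le_norm ENNReal.top_ne_zero x (m.subst y hy)⟩⟩
  map_one' := rfl
  map_mul' _ _ := rfl
  map_zero' := rfl
  map_add' _ _ := rfl
  commutes' _ := rfl
  map_star' _ := rfl

/-- The preimage of `S.subalgebra` is a closed `*`-subalgebra that contains every tuple of
generators. Restricting coordinates is the route to `lift` because `S.Universal` lies one universe
above the models and so is not itself a model. -/
theorem reindex_mem (y : G → S.Universal)
    (hy : ∀ m : Model S, R.Holds m.carrier fun g => eval m (y g)) (x : R.subalgebra) :
    reindex y hy x.1 ∈ S.subalgebra := by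
  have hc : Continuous (reindex y hy) := (reindex y hy).continuous_of_cstarAlgebra
  have hle : R.subalgebra ≤ S.subalgebra.comap (reindex y hy) := by
    refine StarSubalgebra.topologicalClosure_minimal (StarAlgebra.adjoin_le ?_) ?_
    · rintro _ ⟨g, rfl⟩
      exact (y g).2
    · exact (StarSubalgebra.isClosed_topologicalClosure _).preimage hc
  exact hle x.2

/-- The homomorphism of universal C*-algebras given by elements that satisfy the relations in
every model. -/
noncomputable def lift (y : G → S.Universal)
    (hy : ∀ m : Model S, R.Holds m.carrier fun g => eval m (y g)) :
    R.Universal →⋆ₐ[ℂ] S.Universal :=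
  ((reindex y hy).comp R.subalgebra.subtype).codRestrict S.subalgebra (reindex_mem y hy)

end CStarRelations

/-! ### Transport of the relations along homomorphisms and to the universal algebras -/

section Families


variable {A : Type*} {B : Type*} [CStarAlgebra A] [CStarAlgebra B]

theorem IsSemigroupFamily.map {P : Type u} [LeftCancelMonoid P] {w : P → A}
    {e : ConstructibleIdeal P → A} (h : IsSemigroupFamily w e) (f : A →⋆ₐ[ℂ] B) :
    IsSemigroupFamily (fun p => f (w p)) (fun X => f (e X)) where
  isometry p := by rw [← map_star, ← map_mul, h.isometry, map_one]
  projection X := (h.projection X).map f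
  v_mul p q := by rw [h.v_mul, map_mul]
  v_e_star p X := by rw [← map_star, ← map_mul, ← map_mul, h.v_e_star]
  e_whole := by rw [h.e_whole, map_one]
  e_empty := by rw [h.e_empty, map_zero]
  e_inter X Y := by rw [h.e_inter, map_mul]

theorem IsToeplitzFamily.map {R : Type u} [CommRing R] [IsDomain R] {w : R → A} {s : R⁰ → A}
    {e : NonzeroIdeal R → A} (h : IsToeplitzFamily w s e) (f : A →⋆ₐ[ℂ] B) :
    IsToeplitzFamily (fun b => f (w b)) (fun a => f (s a)) (fun I => f (e I)) where
  u_unitary b := by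
    have := Unitary.mem_iff.mp (h.u_unitary b)
    rw [Unitary.mem_iff, ← map_star, ← map_mul, ← map_mul, this.1, this.2, map_one]
    exact ⟨rfl, rfl⟩
  s_isometry a := by rw [← map_star, ← map_mul, h.s_isometry, map_one]
  e_projection I := (h.e_projection I).map f
  u_zero := by rw [h.u_zero, map_one]
  u_s_mul b d a c := by simp only [← map_mul, h.u_s_mul]
  e_inter I J := by rw [h.e_inter, map_mul]
  e_whole := by rw [h.e_whole, map_one]
  s_e_star a I := by rw [← map_star, ← map_mul, ← map_mul, h.s_e_star]
  u_e_mem b I hb := by rw [← map_mul, ← map_mul, h.u_e_mem b I hb]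
  u_e_notMem b I hb := by rw [← map_mul, ← map_mul, ← map_mul, h.u_e_notMem b I hb, map_zero]

theorem FullSemigroupCStar.isSemigroupFamily (P : Type u) [LeftCancelMonoid P] :
    IsSemigroupFamily (FullSemigroupCStar.v (P := P)) FullSemigroupCStar.e where
  isometry p := CStarRelations.Universal.ext_eval fun m => m.holds.isometry p
  projection X :=
    ⟨CStarRelations.Universal.ext_eval fun m => (m.holds.projection X).isIdempotentElem,
      CStarRelations.Universal.ext_eval fun m => (m.holds.projection X).isSelfAdjoint⟩
  v_mul p q := CStarRelations.Universal.ext_eval fun m => m.holds.v_mul p q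
  v_e_star p X := CStarRelations.Universal.ext_eval fun m => m.holds.v_e_star p X
  e_whole := CStarRelations.Universal.ext_eval fun m => m.holds.e_whole
  e_empty := CStarRelations.Universal.ext_eval fun m => m.holds.e_empty
  e_inter X Y := CStarRelations.Universal.ext_eval fun m => m.holds.e_inter X Y

theorem ToeplitzAlgebra.isToeplitzFamily (R : Type u) [CommRing R] [IsDomain R] :
    IsToeplitzFamily (ToeplitzAlgebra.u (R := R)) ToeplitzAlgebra.s ToeplitzAlgebra.e where
  u_unitary b := Unitary.mem_iff.mpr
    ⟨CStarRelations.Universal.ext_eval fun m => (Unitary.mem_iff.mp (m.holds.u_unitary b)).1,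
      CStarRelations.Universal.ext_eval fun m => (Unitary.mem_iff.mp (m.holds.u_unitary b)).2⟩
  s_isometry a := CStarRelations.Universal.ext_eval fun m => m.holds.s_isometry a
  e_projection I :=
    ⟨CStarRelations.Universal.ext_eval fun m => (m.holds.e_projection I).isIdempotentElem,
      CStarRelations.Universal.ext_eval fun m => (m.holds.e_projection I).isSelfAdjoint⟩
  u_zero := CStarRelations.Universal.ext_eval fun m => m.holds.u_zero
  u_s_mul b d a c := CStarRelations.Universal.ext_eval fun m => m.holds.u_s_mul b d a c
  e_inter I J := CStarRelations.Universal.ext_eval fun m => m.holds.e_inter I J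
  e_whole := CStarRelations.Universal.ext_eval fun m => m.holds.e_whole
  s_e_star a I := CStarRelations.Universal.ext_eval fun m => m.holds.s_e_star a I
  u_e_mem b I hb := CStarRelations.Universal.ext_eval fun m => m.holds.u_e_mem b I hb
  u_e_notMem b I hb := CStarRelations.Universal.ext_eval fun m => m.holds.u_e_notMem b I hb

end Families

/-! ### Calculus of the sets `(b + I) × I^×` -/

namespace NonzeroIdeal

variable {R : Type u} [CommRing R]

theorem mem_cosetProd {b : R} {I : NonzeroIdeal R} {x : AxbSemigroup R} :
    x ∈ I.cosetProd b ↔ x.b - b ∈ I.1 ∧ (x.a : R) ∈ I.1 := Iff.rfl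

/-- The ideal `I + J`. -/
def sup (I J : NonzeroIdeal R) : NonzeroIdeal R :=
  ⟨I.1 ⊔ J.1, fun h => I.2 (le_bot_iff.mp (le_sup_left.trans h.le))⟩

theorem cosetProd_inter_cases (b c : R) (I J : NonzeroIdeal R) :
    (b - c ∉ (sup I J).1 ∧ I.cosetProd b ∩ J.cosetProd c = ∅) ∨
      ∃ x, x - b ∈ I.1 ∧ x - c ∈ J.1 := by
  by_cases h : b - c ∈ (sup I J).1
  · obtain ⟨i, hi, j, hj, hij⟩ := Submodule.mem_sup.mp h
    refine Or.inr ⟨b - i, by simpa using hi, ?_⟩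
    rwa [sub_right_comm, ← hij, add_sub_cancel_left]
  · refine Or.inl ⟨h, Set.eq_empty_of_forall_notMem fun x hx => h ?_⟩
    have h1 : x.b - b ∈ (sup I J).1 := Ideal.mem_sup_left hx.1.1
    have h2 : x.b - c ∈ (sup I J).1 := Ideal.mem_sup_right hx.2.1
    simpa using sub_mem h2 h1

/-- The ideal quotient `{x | ax ∈ I}`. -/
def comapMul (a : R) (I : NonzeroIdeal R) : NonzeroIdeal R :=
  ⟨Submodule.comap (LinearMap.mulLeft R a) I.1, fun h => I.2 (le_bot_iff.mp (le_trans
    (fun _ hx => I.1.mul_mem_left a hx) h.le))⟩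

theorem mem_comapMul {a x : R} {I : NonzeroIdeal R} : x ∈ (comapMul a I).1 ↔ a * x ∈ I.1 :=
  Iff.rfl

/-- Once the preimage has a point `y`, its first coordinate serves as base point: membership of `x`
then only involves `p.a * (x.b - y.b)` and `p.a * x.a`. -/
theorem preimage_cosetProd (p : AxbSemigroup R) (b : R) (I : NonzeroIdeal R) :
    (fun x => p * x) ⁻¹' I.cosetProd b = ∅ ∨
      ∃ c, (fun x => p * x) ⁻¹' I.cosetProd b = (comapMul (p.a : R) I).cosetProd c := by
  rcases Set.eq_empty_or_nonempty ((fun x => p * x) ⁻¹' I.cosetProd b) with h | ⟨y, hy⟩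
  · exact Or.inl h
  · refine Or.inr ⟨y.b, Set.ext fun x => ?_⟩
    have hy1 : p.b + p.a * y.b - b ∈ I.1 := hy.1
    have hx : p.b + p.a * x.b - b = p.a * (x.b - y.b) + (p.b + p.a * y.b - b) := by ring
    simp only [Set.mem_preimage, mem_cosetProd, mem_comapMul, AxbSemigroup.mul_def,
      Submonoid.coe_mul, hx, Ideal.add_mem_iff_left _ hy1]

variable [IsDomain R]

theorem mem_whole (x : R) : x ∈ (whole : NonzeroIdeal R).1 := Submodule.mem_top

theorem mem_inter {I J : NonzeroIdeal R} {x : R} : x ∈ (inter I J).1 ↔ x ∈ I.1 ∧ x ∈ J.1 :=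
  Submodule.mem_inf

theorem mem_leftMul {a : R⁰} {I : NonzeroIdeal R} {x : R} :
    x ∈ (leftMul a I).1 ↔ ∃ y ∈ I.1, (a : R) * y = x := Ideal.mem_span_singleton_mul

theorem leftMul_one (I : NonzeroIdeal R) : leftMul 1 I = I := Subtype.ext (by simp [leftMul])

theorem exists_nonZeroDivisor_mem (I : NonzeroIdeal R) : ∃ a : R⁰, (a : R) ∈ I.1 := by
  obtain ⟨a, ha, h0⟩ := Submodule.exists_mem_ne_zero_of_ne_bot I.2
  exact ⟨⟨a, mem_nonZeroDivisors_of_ne_zero h0⟩, ha⟩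

theorem cosetProd_ne_empty (b : R) (I : NonzeroIdeal R) : I.cosetProd b ≠ ∅ := by
  obtain ⟨a, ha⟩ := I.exists_nonZeroDivisor_mem
  exact Set.nonempty_iff_ne_empty.mp ⟨⟨b, a⟩, by simpa [mem_cosetProd] using ha⟩

/-- Fixing a nonzero `a ∈ I` as second coordinate recovers the coset `b + I`, which determines `I`
and the class of `b`. -/
theorem cosetProd_eq_iff {b c : R} {I J : NonzeroIdeal R} :
    I.cosetProd b = J.cosetProd c ↔ I = J ∧ b - c ∈ I.1 := by
  constructor
  · intro h
    obtain ⟨a, ha⟩ := I.exists_nonZeroDivisor_mem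
    have key (x : AxbSemigroup R) : x ∈ I.cosetProd b ↔ x ∈ J.cosetProd c := by rw [h]
    have hb : b - c ∈ J.1 := ((key ⟨b, a⟩).mp (by simpa [mem_cosetProd] using ha)).1
    have hIJ : I = J := by
      refine Subtype.ext (SetLike.ext fun x => ?_)
      have := key ⟨b + x, a⟩
      have haJ : (a : R) ∈ J.1 := ((key ⟨b, a⟩).mp (by simpa [mem_cosetProd] using ha)).2
      simp only [mem_cosetProd, ha, haJ, and_true, add_sub_cancel_left] at this
      rw [this, add_sub_right_comm, Ideal.add_mem_iff_right _ hb]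
    exact ⟨hIJ, hIJ ▸ hb⟩
  · rintro ⟨rfl, h⟩
    ext x
    rw [mem_cosetProd, mem_cosetProd, ← sub_add_sub_cancel x.b b c, Ideal.add_mem_iff_left _ h]

theorem cosetProd_whole (b : R) : (whole : NonzeroIdeal R).cosetProd b = Set.univ :=
  Set.eq_univ_of_forall fun _ => ⟨Submodule.mem_top, Submodule.mem_top⟩

theorem image_cosetProd (p : AxbSemigroup R) (b : R) (I : NonzeroIdeal R) :
    (fun x => p * x) '' I.cosetProd b = (leftMul p.a I).cosetProd (p.b + p.a * b) := by
  ext x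
  simp only [Set.mem_image, mem_cosetProd, mem_leftMul]
  constructor
  · rintro ⟨y, ⟨h1, h2⟩, rfl⟩
    exact ⟨⟨_, h1, by simp only [AxbSemigroup.mul_def]; ring⟩, ⟨_, h2, rfl⟩⟩
  · rintro ⟨⟨y, hy, h1⟩, ⟨z, hz, h2⟩⟩
    -- The second coordinate of the preimage must lie in `R⁰`, not merely in `I`.
    have hz0 : z ≠ 0 := by
      rintro rfl
      exact nonZeroDivisors.ne_zero x.a.2 (by rw [← h2, mul_zero])
    refine ⟨⟨b + y, ⟨z, mem_nonZeroDivisors_of_ne_zero hz0⟩⟩, ⟨by simpa using hy, hz⟩, ?_⟩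
    ext
    · simp only [AxbSemigroup.mul_def]
      linear_combination h1
    · exact h2

theorem cosetProd_inter_of_mem {b c x : R} {I J : NonzeroIdeal R} (hI : x - b ∈ I.1)
    (hJ : x - c ∈ J.1) : I.cosetProd b ∩ J.cosetProd c = (inter I J).cosetProd x := by
  have h1 : I.cosetProd b = I.cosetProd x :=
    cosetProd_eq_iff.mpr ⟨rfl, by rw [← neg_sub]; exact neg_mem hI⟩
  have h2 : J.cosetProd c = J.cosetProd x :=
    cosetProd_eq_iff.mpr ⟨rfl, by rw [← neg_sub]; exact neg_mem hJ⟩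
  rw [h1, h2]
  ext y
  simp only [Set.mem_inter_iff, mem_cosetProd, mem_inter]
  tauto

theorem inter_sup_self (I J : NonzeroIdeal R) : inter I (sup I J) = I :=
  Subtype.ext inf_sup_self

theorem sup_inter_self (I J : NonzeroIdeal R) : inter (sup I J) J = J :=
  Subtype.ext (inf_eq_right.mpr le_sup_right)

end NonzeroIdeal

/-! ### Determination of the constructible right ideals -/

section Dedekind

variable {R : Type u} [CommRing R]

open NonzeroIdeal

/-- The sets `(b + I) × I^×` together with `∅` are stable under all the operations; this needs only
a domain. -/
theorem IsConstructible.eq_empty_or_cosetProd [IsDomain R] {X : Set (AxbSemigroup R)}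
    (hX : IsConstructible (AxbSemigroup R) X) :
    X = ∅ ∨ ∃ (b : R) (I : NonzeroIdeal R), X = I.cosetProd b := by
  induction hX with
  | univ => exact Or.inr ⟨0, whole, (cosetProd_whole 0).symm⟩
  | empty => exact Or.inl rfl
  | image p X _ ih =>
    rcases ih with rfl | ⟨b, I, rfl⟩
    · exact Or.inl (Set.image_empty _)
    · exact Or.inr ⟨_, _, image_cosetProd p b I⟩
  | preimage p X _ ih =>
    rcases ih with rfl | ⟨b, I, rfl⟩
    · exact Or.inl Set.preimage_empty
    · rcases preimage_cosetProd p b I with h | ⟨c, h⟩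
      · exact Or.inl h
      · exact Or.inr ⟨c, _, h⟩
  | inter X Y _ _ ihX ihY =>
    rcases ihX with rfl | ⟨b, I, rfl⟩
    · exact Or.inl (Set.empty_inter _)
    rcases ihY with rfl | ⟨c, J, rfl⟩
    · exact Or.inl (Set.inter_empty _)
    rcases cosetProd_inter_cases b c I J with ⟨-, h⟩ | ⟨x, hI, hJ⟩
    · exact Or.inl h
    · exact Or.inr ⟨x, _, cosetProd_inter_of_mem hI hJ⟩

/-- In a Dedekind domain, every nonzero ideal has the form `{x | ax ∈ bR}` with nonzero `a`, `b`. -/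
theorem NonzeroIdeal.exists_mem_iff_dvd_mul [IsDedekindDomain R] (I : NonzeroIdeal R) :
    ∃ a b : R⁰, ∀ x, x ∈ I.1 ↔ (b : R) ∣ a * x := by
  obtain ⟨b, hb⟩ := I.exists_nonZeroDivisor_mem
  have hb0 : (b : R) ≠ 0 := nonZeroDivisors.ne_zero b.2
  have hsb : Ideal.span {(b : R)} ≠ 0 := by
    rw [Ne, Ideal.zero_eq_bot, Ideal.span_singleton_eq_bot]
    exact hb0
  -- Write `bR = IJ` and `J = bR + aR`. Cancelling `J`, `x ∈ I` iff `xJ ⊆ bR`, that is, iff `b`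
  -- divides `xb` and `xa`; the first is automatic.
  obtain ⟨J, hJ⟩ := Ideal.dvd_iff_le.mpr ((Ideal.span_singleton_le_iff_mem I.1).mpr hb)
  have hJ0 : J ≠ 0 := right_ne_zero_of_mul (hJ ▸ hsb)
  obtain ⟨a, ha⟩ := IsDedekindDomain.exists_sup_span_eq (I := Ideal.span {(b : R)}) (J := J)
    (hJ ▸ Ideal.mul_le_right (I := I.1) (J := J)) hsb
  have key (a : R) (ha : Ideal.span {(b : R)} ⊔ Ideal.span {a} = J) (x : R) :
      x ∈ I.1 ↔ (b : R) ∣ a * x := by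
    rw [← Ideal.span_singleton_le_iff_mem, ← Ideal.dvd_iff_le,
      ← mul_dvd_mul_iff_right hJ0, ← hJ, Ideal.dvd_iff_le, ← ha, Ideal.mul_sup,
      Ideal.span_singleton_mul_span_singleton, Ideal.span_singleton_mul_span_singleton, sup_le_iff,
      Ideal.span_singleton_le_span_singleton, Ideal.span_singleton_le_span_singleton, mul_comm x a]
    exact and_iff_right (dvd_mul_left _ _)
  -- If `a = 0` then `J = bR`, and `b` can replace `a` as the second generator.
  by_cases ha0 : a = 0
  · refine ⟨b, b, key b ?_⟩
    rw [← ha, ha0]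
    simp
  · exact ⟨⟨a, mem_nonZeroDivisors_of_ne_zero ha0⟩, b, key a ha⟩

theorem NonzeroIdeal.isConstructible_cosetProd [IsDedekindDomain R] (b : R) (I : NonzeroIdeal R) :
    IsConstructible (AxbSemigroup R) (I.cosetProd b) := by
  obtain ⟨a, c, h⟩ := I.exists_mem_iff_dvd_mul
  have hI : comapMul (a : R) (leftMul c whole) = I := by
    refine Subtype.ext (SetLike.ext fun x => ?_)
    rw [h, mem_comapMul, mem_leftMul]
    exact ⟨fun ⟨y, _, hy⟩ => ⟨y, hy.symm⟩, fun ⟨y, hy⟩ => ⟨y, mem_whole y, hy.symm⟩⟩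
  -- `I × I^×` is `(0,a)⁻¹(0,c)P`; translation by `(b,1)` then gives the general coset.
  have h0 : I.cosetProd 0 = (fun x => (⟨0, a⟩ : AxbSemigroup R) * x) ⁻¹'
      ((fun x => (⟨0, c⟩ : AxbSemigroup R) * x) '' Set.univ) := by
    rw [← cosetProd_whole 0, image_cosetProd]
    ext x
    rw [← hI]
    simp [mem_cosetProd, mem_comapMul, AxbSemigroup.mul_def]
  have hb : I.cosetProd b = (fun x => (⟨b, 1⟩ : AxbSemigroup R) * x) '' I.cosetProd 0 := by
    rw [image_cosetProd, leftMul_one, mul_zero, add_zero]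
  rw [hb, h0]
  exact .image _ _ (.preimage _ _ (.image _ _ .univ))

theorem isConstructible_axb_iff [IsDedekindDomain R] (X : Set (AxbSemigroup R)) :
    IsConstructible (AxbSemigroup R) X ↔
      X = ∅ ∨ ∃ (b : R) (I : NonzeroIdeal R), X = I.cosetProd b := by
  refine ⟨IsConstructible.eq_empty_or_cosetProd, ?_⟩
  rintro (rfl | ⟨b, I, rfl⟩)
  · exact .empty
  · exact I.isConstructible_cosetProd b

end Dedekind

/-! ### Consequences of the Toeplitz relations -/

namespace IsToeplitzFamily

open NonzeroIdeal

variable {R : Type u} [CommRing R] [IsDomain R] {A : Type v} [CStarAlgebra A]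
  {w : R → A} {s : R⁰ → A} {e : NonzeroIdeal R → A}

/-- An idempotent isometry is `1`: cancel `s 1` on the left in `s 1 * s 1 = s 1`. -/
theorem s_one (h : IsToeplitzFamily w s e) : s 1 = 1 := by
  have h1 := h.u_s_mul 0 0 1 1
  simp only [h.u_zero, one_mul, mul_zero, add_zero] at h1
  rw [← one_mul (s 1), ← h.s_isometry 1, mul_assoc, h1]

theorem u_add (h : IsToeplitzFamily w s e) (b d : R) : w (b + d) = w b * w d := by
  simpa [h.s_one] using (h.u_s_mul b d 1 1).symm

theorem s_mul_u (h : IsToeplitzFamily w s e) (a : R⁰) (d : R) : s a * w d = w (a * d) * s a := by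
  simpa [h.u_zero, h.s_one] using h.u_s_mul 0 d a 1

theorem u_mul_u_neg (h : IsToeplitzFamily w s e) (b : R) : w b * w (-b) = 1 := by
  rw [← h.u_add, add_neg_cancel, h.u_zero]

theorem u_neg_mul_u (h : IsToeplitzFamily w s e) (b : R) : w (-b) * w b = 1 := by
  rw [← h.u_add, neg_add_cancel, h.u_zero]

theorem star_u (h : IsToeplitzFamily w s e) (b : R) : star (w b) = w (-b) := by
  rw [← mul_one (star (w b)), ← h.u_mul_u_neg b, ← mul_assoc,
    (Unitary.mem_iff.mp (h.u_unitary b)).1, one_mul]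

/-- Here `I = J` and `u^b = u^c u^{b-c}`, where conjugation by `u^{b-c}` fixes `e_I`. This makes
`constructibleProjection` independent of the chosen representative. -/
theorem conj_eq_of_cosetProd_eq (h : IsToeplitzFamily w s e) {b c : R} {I J : NonzeroIdeal R}
    (hIJ : I.cosetProd b = J.cosetProd c) : w b * e I * w (-b) = w c * e J * w (-c) := by
  obtain ⟨rfl, hbc⟩ := cosetProd_eq_iff.mp hIJ
  have h1 : w b = w c * w (b - c) := by rw [← h.u_add, add_sub_cancel]
  have h2 : w (-b) = w (-(b - c)) * w (-c) := by rw [← h.u_add]; congr 1; ring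
  calc w b * e I * w (-b) = w c * (w (b - c) * e I * w (-(b - c))) * w (-c) := by
        rw [h1, h2]; simp only [mul_assoc]
    _ = w c * e I * w (-c) := by rw [h.u_e_mem _ _ hbc]

theorem conj_mul_conj (h : IsToeplitzFamily w s e) (b : R) (I J : NonzeroIdeal R) :
    w b * e I * w (-b) * (w b * e J * w (-b)) = w b * e (inter I J) * w (-b) := by
  rw [h.e_inter]
  simp only [mul_assoc]
  rw [← mul_assoc (w (-b)) (w b), h.u_neg_mul_u, one_mul]

/-- The relations give orthogonality only for translates of a single ideal. Since `e_I` and `e_J`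
are absorbed by `e_{I+J}`, the case of `I + J` suffices. -/
theorem e_mul_u_mul_e (h : IsToeplitzFamily w s e) {d : R} {I J : NonzeroIdeal R} (hd : d ∉ (sup I J).1) :
    e I * w d * e J = 0 := by
  have h1 : e (sup I J) * w d * e (sup I J) = 0 := by
    -- Multiplying this relation by `u^d` on the left leaves `e_{I+J} u^d e_{I+J} = 0`.
    have h2 := h.u_e_notMem (-d) (sup I J) (by rwa [neg_mem_iff])
    rw [neg_neg] at h2
    rw [← one_mul (e (sup I J)), ← h.u_mul_u_neg d]
    simp only [mul_assoc] at h2 ⊢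
    rw [← mul_assoc (w d) (w (-d)) (e _), h.u_mul_u_neg, one_mul, h2, mul_zero]
  have hI : e I = e I * e (sup I J) := by rw [← h.e_inter, inter_sup_self]
  have hJ : e J = e (sup I J) * e J := by rw [← h.e_inter, sup_inter_self]
  calc e I * w d * e J = e I * e (sup I J) * w d * (e (sup I J) * e J) := by rw [← hI, ← hJ]
    _ = e I * (e (sup I J) * w d * e (sup I J)) * e J := by simp only [mul_assoc]
    _ = 0 := by rw [h1, mul_zero, zero_mul]

theorem conj_mul_conj_eq_zero (h : IsToeplitzFamily w s e) {b c : R} {I J : NonzeroIdeal R} (hbc : b - c ∉ (sup I J).1) :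
    w b * e I * w (-b) * (w c * e J * w (-c)) = 0 := by
  have h1 := h.e_mul_u_mul_e (d := -b + c) (I := I) (J := J)
    (by rwa [← neg_mem_iff, neg_add_rev, neg_neg, neg_add_eq_sub])
  calc w b * e I * w (-b) * (w c * e J * w (-c))
      = w b * (e I * (w (-b) * w c) * e J) * w (-c) := by simp only [mul_assoc]
    _ = 0 := by rw [← h.u_add, h1, mul_zero, zero_mul]

theorem isStarProjection_conj (h : IsToeplitzFamily w s e) (b : R) (I : NonzeroIdeal R) :
    IsStarProjection (w b * e I * w (-b)) where
  isIdempotentElem := by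
    rw [IsIdempotentElem, h.conj_mul_conj, h.e_inter, (h.e_projection I).isIdempotentElem.eq]
  isSelfAdjoint := by
    rw [isSelfAdjoint_iff, star_mul, star_mul, h.star_u, h.star_u, neg_neg,
      (h.e_projection I).isSelfAdjoint.star_eq, mul_assoc]

end IsToeplitzFamily

/-! ### From Toeplitz families to semigroup families -/

section Translation

open NonzeroIdeal

variable {R : Type u} [CommRing R] [IsDomain R] {A : Type v} [CStarAlgebra A]

open Classical in
/-- The projections `u^b e_I u^{-b}`, indexed by the constructible ideals `(b + I) × I^×`. -/
noncomputable def constructibleProjection (w : R → A) (e : NonzeroIdeal R → A)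
    (X : ConstructibleIdeal (AxbSemigroup R)) : A :=
  if hX : ∃ p : R × NonzeroIdeal R, X.1 = p.2.cosetProd p.1 then
    w hX.choose.1 * e hX.choose.2 * w (-hX.choose.1)
  else 0

theorem constructibleProjection_of_eq_empty (w : R → A) (e : NonzeroIdeal R → A)
    {X : ConstructibleIdeal (AxbSemigroup R)} (hX : X.1 = ∅) :
    constructibleProjection w e X = 0 :=
  dif_neg fun ⟨p, hp⟩ => cosetProd_ne_empty p.1 p.2 (hp.symm.trans hX)

theorem IsToeplitzFamily.constructibleProjection_eq {w : R → A} {s : R⁰ → A}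
    {e : NonzeroIdeal R → A} (h : IsToeplitzFamily w s e)
    {X : ConstructibleIdeal (AxbSemigroup R)} {b : R} {I : NonzeroIdeal R}
    (hX : X.1 = I.cosetProd b) : constructibleProjection w e X = w b * e I * w (-b) := by
  have hX' : ∃ p : R × NonzeroIdeal R, X.1 = p.2.cosetProd p.1 := ⟨(b, I), hX⟩
  rw [constructibleProjection, dif_pos hX']
  exact h.conj_eq_of_cosetProd_eq (hX'.choose_spec.symm.trans hX)

theorem ConstructibleIdeal.empty_or_cosetProd (X : ConstructibleIdeal (AxbSemigroup R)) :
    X.1 = ∅ ∨ ∃ (b : R) (I : NonzeroIdeal R), X.1 = I.cosetProd b :=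
  X.2.eq_empty_or_cosetProd

theorem IsToeplitzFamily.isSemigroupFamily {w : R → A} {s : R⁰ → A} {e : NonzeroIdeal R → A}
    (h : IsToeplitzFamily w s e) :
    IsSemigroupFamily (fun p : AxbSemigroup R => w p.b * s p.a) (constructibleProjection w e) where
  isometry p := by
    rw [star_mul, mul_assoc, ← mul_assoc (star (w p.b)),
      (Unitary.mem_iff.mp (h.u_unitary p.b)).1, one_mul, h.s_isometry]
  projection X := by
    rcases X.empty_or_cosetProd with hX | ⟨b, I, hX⟩
    · rw [constructibleProjection_of_eq_empty w e hX]
      exact .zero A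
    · rw [h.constructibleProjection_eq hX]
      exact h.isStarProjection_conj b I
  v_mul p q := (h.u_s_mul p.b q.b p.a q.a).symm
  v_e_star p X := by
    rcases X.empty_or_cosetProd with hX | ⟨b, I, hX⟩
    · have hpX : (ConstructibleIdeal.leftMul p X).1 = ∅ :=
        (congrArg _ hX).trans (Set.image_empty _)
      rw [constructibleProjection_of_eq_empty w e hX, constructibleProjection_of_eq_empty w e hpX,
        mul_zero, zero_mul]
    · have hpX : (ConstructibleIdeal.leftMul p X).1 =
          (NonzeroIdeal.leftMul p.a I).cosetProd (p.b + p.a * b) :=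
        (congrArg _ hX).trans (image_cosetProd p b I)
      -- This is the adjoint of `s_a u^b = u^{ab} s_a`.
      have hs : w (-b) * star (s p.a) = star (s p.a) * w (-(p.a * b)) := by
        rw [← h.star_u, ← h.star_u, ← star_mul, ← star_mul, h.s_mul_u]
      rw [h.constructibleProjection_eq hX, h.constructibleProjection_eq hpX, ← h.s_e_star,
        h.u_add, neg_add_rev, h.u_add, star_mul, h.star_u]
      calc w p.b * s p.a * (w b * e I * w (-b)) * (star (s p.a) * w (-p.b))
          = w p.b * (s p.a * w b) * e I * (w (-b) * star (s p.a)) * w (-p.b) := by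
            simp only [mul_assoc]
        _ = _ := by rw [h.s_mul_u, hs]; simp only [mul_assoc]
  e_whole := by
    rw [h.constructibleProjection_eq (b := 0) (I := .whole) (cosetProd_whole 0).symm, h.e_whole,
      mul_one, h.u_mul_u_neg]
  e_empty := constructibleProjection_of_eq_empty w e rfl
  e_inter X Y := by
    rcases X.empty_or_cosetProd with hX | ⟨b, I, hX⟩
    · rw [constructibleProjection_of_eq_empty w e hX, zero_mul,
        constructibleProjection_of_eq_empty w e]
      exact (congrArg (· ∩ Y.1) hX).trans (Set.empty_inter _)
    rcases Y.empty_or_cosetProd with hY | ⟨c, J, hY⟩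
    · rw [constructibleProjection_of_eq_empty w e hY, mul_zero,
        constructibleProjection_of_eq_empty w e]
      exact (congrArg (X.1 ∩ ·) hY).trans (Set.inter_empty _)
    have hXY : (ConstructibleIdeal.inter X Y).1 = I.cosetProd b ∩ J.cosetProd c :=
      congrArg₂ (· ∩ ·) hX hY
    -- Disjoint cosets give orthogonal projections; otherwise both are rebased at the common point
    -- `x`, where the claim is `e_I e_J = e_{I ∩ J}` conjugated by `u^x`.
    rcases cosetProd_inter_cases b c I J with ⟨hbc, hIJ⟩ | ⟨x, hI, hJ⟩
    · rw [constructibleProjection_of_eq_empty w e (hXY.trans hIJ), h.constructibleProjection_eq hX,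
        h.constructibleProjection_eq hY, h.conj_mul_conj_eq_zero hbc]
    · have hX' : X.1 = I.cosetProd x := hX.trans
        (cosetProd_eq_iff.mpr ⟨rfl, by rw [← neg_sub]; exact neg_mem hI⟩)
      have hY' : Y.1 = J.cosetProd x := hY.trans
        (cosetProd_eq_iff.mpr ⟨rfl, by rw [← neg_sub]; exact neg_mem hJ⟩)
      rw [h.constructibleProjection_eq (hXY.trans (cosetProd_inter_of_mem hI hJ)),
        h.constructibleProjection_eq hX', h.constructibleProjection_eq hY', h.conj_mul_conj]

end Translation

/-! ### From semigroup families to Toeplitz families -/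

section Inverse

variable {R : Type u} [CommRing R] [IsDedekindDomain R] {A : Type v} [CStarAlgebra A]

/-- The constructible right ideal `(b + I) × I^×`. -/
def NonzeroIdeal.constructible (b : R) (I : NonzeroIdeal R) :
    ConstructibleIdeal (AxbSemigroup R) := ⟨I.cosetProd b, I.isConstructible_cosetProd b⟩

theorem NonzeroIdeal.leftMul_constructible (p : AxbSemigroup R) (b : R) (I : NonzeroIdeal R) :
    ConstructibleIdeal.leftMul p (I.constructible b) =
      (NonzeroIdeal.leftMul p.a I).constructible (p.b + p.a * b) :=
  Subtype.ext (image_cosetProd p b I)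

theorem IsSemigroupFamily.v_one {P : Type u} [LeftCancelMonoid P] {w : P → A}
    {e : ConstructibleIdeal P → A} (h : IsSemigroupFamily w e) : w 1 = 1 := by
  rw [← one_mul (w 1), ← h.isometry 1, mul_assoc, ← h.v_mul, mul_one]

theorem IsSemigroupFamily.translation_mul_neg {w : AxbSemigroup R → A}
    {e : ConstructibleIdeal (AxbSemigroup R) → A} (h : IsSemigroupFamily w e) (b : R) :
    w ⟨b, 1⟩ * w ⟨-b, 1⟩ = 1 := by
  rw [← h.v_mul, ← h.v_one]
  congr 1
  ext <;> simp [AxbSemigroup.mul_def, AxbSemigroup.one_def]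

/-- `(b,1)` is invertible in `P`, so its isometry has a right inverse, which must be its adjoint. -/
theorem IsSemigroupFamily.star_translation {w : AxbSemigroup R → A}
    {e : ConstructibleIdeal (AxbSemigroup R) → A} (h : IsSemigroupFamily w e) (b : R) :
    star (w ⟨b, 1⟩) = w ⟨-b, 1⟩ := by
  rw [← mul_one (star _), ← h.translation_mul_neg b, ← mul_assoc, h.isometry, one_mul]

theorem IsSemigroupFamily.translation_conj {w : AxbSemigroup R → A}
    {e : ConstructibleIdeal (AxbSemigroup R) → A} (h : IsSemigroupFamily w e) (b : R)
    (I : NonzeroIdeal R) :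
    w ⟨b, 1⟩ * e (I.constructible 0) * w ⟨-b, 1⟩ = e (I.constructible b) := by
  rw [← h.star_translation, h.v_e_star, NonzeroIdeal.leftMul_constructible,
    NonzeroIdeal.leftMul_one, mul_zero, add_zero]

theorem IsSemigroupFamily.isToeplitzFamily {w : AxbSemigroup R → A}
    {e : ConstructibleIdeal (AxbSemigroup R) → A} (h : IsSemigroupFamily w e) :
    IsToeplitzFamily (fun b => w ⟨b, 1⟩) (fun a => w ⟨0, a⟩) (fun I => e (I.constructible 0)) where
  u_unitary b := by
    refine Unitary.mem_iff.mpr ⟨h.isometry _, ?_⟩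
    rw [h.star_translation, h.translation_mul_neg]
  s_isometry a := h.isometry _
  e_projection I := h.projection _
  u_zero := h.v_one
  u_s_mul b d a c := by
    simp only [← h.v_mul]
    congr 1
    ext <;> simp [AxbSemigroup.mul_def]
  e_inter I J := by
    rw [← h.e_inter]
    congr 1
    exact Subtype.ext (NonzeroIdeal.cosetProd_inter_of_mem (by simp) (by simp)).symm
  e_whole := by
    rw [← h.e_whole]
    congr 1
    exact Subtype.ext (NonzeroIdeal.cosetProd_whole 0)
  s_e_star a I := by
    rw [h.v_e_star, NonzeroIdeal.leftMul_constructible, mul_zero, add_zero]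
  u_e_mem b I hb := by
    rw [h.translation_conj]
    congr 1
    exact Subtype.ext (NonzeroIdeal.cosetProd_eq_iff.mpr ⟨rfl, by simpa using hb⟩)
  u_e_notMem b I hb := by
    -- For `b ∉ I` the cosets `b + I` and `I` are disjoint, so the product is `e_∅ = 0`.
    rw [h.translation_conj, ← h.e_inter, ← h.e_empty]
    congr 1
    refine Subtype.ext (Set.eq_empty_of_forall_notMem fun x hx => hb ?_)
    simpa using sub_mem hx.2.1 hx.1.1

end Inverse

/-! ### The two mutually inverse homomorphisms -/

section Isomorphism

variable (R : Type u) [CommRing R] [IsDedekindDomain R]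

/-- The homomorphism `C*(R ⋊ R^×) → 𝔗[R]` with `v_(b,a) ↦ u^b s_a`. -/
noncomputable def FullSemigroupCStar.toToeplitz :
    FullSemigroupCStar (AxbSemigroup R) →⋆ₐ[ℂ] ToeplitzAlgebra R :=
  CStarRelations.lift (R := semigroupRelations (AxbSemigroup R)) (S := toeplitzRelations R)
    (Sum.elim (fun p => ToeplitzAlgebra.u p.b * ToeplitzAlgebra.s p.a)
      (constructibleProjection ToeplitzAlgebra.u ToeplitzAlgebra.e))
    fun m => (ToeplitzAlgebra.isToeplitzFamily R).isSemigroupFamily.map (CStarRelations.eval m)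

/-- The homomorphism `𝔗[R] → C*(R ⋊ R^×)` with `u^b ↦ v_(b,1)`, `s_a ↦ v_(0,a)`. -/
noncomputable def ToeplitzAlgebra.toFullSemigroup :
    ToeplitzAlgebra R →⋆ₐ[ℂ] FullSemigroupCStar (AxbSemigroup R) :=
  CStarRelations.lift (R := toeplitzRelations R) (S := semigroupRelations (AxbSemigroup R))
    (Sum.elim (fun b => FullSemigroupCStar.v ⟨b, 1⟩) (Sum.elim
      (fun a => FullSemigroupCStar.v ⟨0, a⟩)
      (fun I => FullSemigroupCStar.e (I.constructible 0))))
    fun m => (FullSemigroupCStar.isSemigroupFamily (AxbSemigroup R)).isToeplitzFamily.map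
      (CStarRelations.eval m)

variable {R}

theorem FullSemigroupCStar.hom_ext {P : Type u} [LeftCancelMonoid P] {B : Type v} [CStarAlgebra B]
    {f g : FullSemigroupCStar P →⋆ₐ[ℂ] B} (hv : ∀ p, f (v p) = g (v p))
    (he : ∀ X, f (e X) = g (e X)) : f = g :=
  CStarRelations.Universal.hom_ext (R := semigroupRelations P) (Sum.rec hv he)

theorem ToeplitzAlgebra.hom_ext {R : Type u} [CommRing R] [IsDomain R] {B : Type v}
    [CStarAlgebra B] {f g : ToeplitzAlgebra R →⋆ₐ[ℂ] B} (hu : ∀ b, f (u b) = g (u b))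
    (hs : ∀ a, f (s a) = g (s a)) (he : ∀ I, f (e I) = g (e I)) : f = g :=
  CStarRelations.Universal.hom_ext (R := toeplitzRelations R) (Sum.rec hu (Sum.rec hs he))

/-- `lift` acts by selecting coordinates, so its values on generators hold by definition. -/
theorem FullSemigroupCStar.toToeplitz_v (p : AxbSemigroup R) :
    toToeplitz R (v p) = ToeplitzAlgebra.u p.b * ToeplitzAlgebra.s p.a := rfl

theorem FullSemigroupCStar.toToeplitz_e_of_eq_empty {X : ConstructibleIdeal (AxbSemigroup R)}
    (hX : X.1 = ∅) : toToeplitz R (e X) = 0 :=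
  constructibleProjection_of_eq_empty ToeplitzAlgebra.u ToeplitzAlgebra.e hX

theorem FullSemigroupCStar.toToeplitz_e {X : ConstructibleIdeal (AxbSemigroup R)} {b : R}
    {I : NonzeroIdeal R} (hX : X.1 = I.cosetProd b) : toToeplitz R (e X) =
      ToeplitzAlgebra.u b * ToeplitzAlgebra.e I * ToeplitzAlgebra.u (-b) :=
  (ToeplitzAlgebra.isToeplitzFamily R).constructibleProjection_eq hX

theorem ToeplitzAlgebra.toFullSemigroup_u (b : R) :
    toFullSemigroup R (u b) = FullSemigroupCStar.v ⟨b, 1⟩ := rfl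

theorem ToeplitzAlgebra.toFullSemigroup_s (a : R⁰) :
    toFullSemigroup R (s a) = FullSemigroupCStar.v ⟨0, a⟩ := rfl

theorem ToeplitzAlgebra.toFullSemigroup_e (I : NonzeroIdeal R) :
    toFullSemigroup R (e I) = FullSemigroupCStar.e (I.constructible 0) := rfl

theorem ToeplitzAlgebra.toFullSemigroup_comp :
    (toFullSemigroup R).comp (FullSemigroupCStar.toToeplitz R) = .id ℂ _ := by
  have h := FullSemigroupCStar.isSemigroupFamily (AxbSemigroup R)
  refine FullSemigroupCStar.hom_ext (fun p => ?_) fun X => ?_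
  · rw [StarAlgHom.comp_apply, FullSemigroupCStar.toToeplitz_v, map_mul, toFullSemigroup_u,
      toFullSemigroup_s, ← h.v_mul, StarAlgHom.coe_id, id_eq]
    congr 1
    ext <;> simp [AxbSemigroup.mul_def]
  · rw [StarAlgHom.comp_apply, StarAlgHom.coe_id, id_eq]
    rcases X.empty_or_cosetProd with hX | ⟨b, I, hX⟩
    · rw [FullSemigroupCStar.toToeplitz_e_of_eq_empty hX, map_zero, ← h.e_empty]
      congr 1
      exact Subtype.ext hX.symm
    · rw [FullSemigroupCStar.toToeplitz_e hX, map_mul, map_mul, toFullSemigroup_u,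
        toFullSemigroup_u, toFullSemigroup_e, h.translation_conj]
      congr 1
      exact Subtype.ext hX.symm

theorem FullSemigroupCStar.toToeplitz_comp :
    (toToeplitz R).comp (ToeplitzAlgebra.toFullSemigroup R) = .id ℂ _ := by
  have h := ToeplitzAlgebra.isToeplitzFamily R
  refine ToeplitzAlgebra.hom_ext (fun b => ?_) (fun a => ?_) fun I => ?_
  · rw [StarAlgHom.comp_apply, ToeplitzAlgebra.toFullSemigroup_u, toToeplitz_v, h.s_one, mul_one,
      StarAlgHom.coe_id, id_eq]
  · rw [StarAlgHom.comp_apply, ToeplitzAlgebra.toFullSemigroup_s, toToeplitz_v, h.u_zero, one_mul,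
      StarAlgHom.coe_id, id_eq]
  · rw [StarAlgHom.comp_apply, ToeplitzAlgebra.toFullSemigroup_e,
      toToeplitz_e (b := 0) (I := I) rfl, neg_zero, h.u_zero, one_mul, mul_one,
      StarAlgHom.coe_id, id_eq]

variable (R) in
/-- The isomorphism `C*(R ⋊ R^×) ≃ 𝔗[R]`. -/
noncomputable def FullSemigroupCStar.equivToeplitz :
    FullSemigroupCStar (AxbSemigroup R) ≃⋆ₐ[ℂ] ToeplitzAlgebra R :=
  .ofStarAlgHom (toToeplitz R) (ToeplitzAlgebra.toFullSemigroup R)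
    ToeplitzAlgebra.toFullSemigroup_comp toToeplitz_comp

end Isomorphism

theorem mainTheorem9 (K : Type*) [Field K] [NumberField K] :
    -- the constructible right ideals are exactly `∅` and the sets `(b + I) × I^×`
    (∀ X : Set (AxbSemigroup (𝓞 K)), IsConstructible (AxbSemigroup (𝓞 K)) X ↔
      X = ∅ ∨ ∃ (b : 𝓞 K) (I : NonzeroIdeal (𝓞 K)), X = I.cosetProd b) ∧
    ∃! φ : FullSemigroupCStar (AxbSemigroup (𝓞 K)) ≃⋆ₐ[ℂ] ToeplitzAlgebra (𝓞 K),
      (∀ (b : 𝓞 K) (a : (𝓞 K)⁰),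
        φ (FullSemigroupCStar.v ⟨b, a⟩) = ToeplitzAlgebra.u b * ToeplitzAlgebra.s a) ∧
      (∀ (b : 𝓞 K) (I : NonzeroIdeal (𝓞 K)) (X : ConstructibleIdeal (AxbSemigroup (𝓞 K))),
        X.1 = I.cosetProd b → φ (FullSemigroupCStar.e X) =
          ToeplitzAlgebra.u b * ToeplitzAlgebra.e I * ToeplitzAlgebra.u (-b)) ∧
      φ (FullSemigroupCStar.e .empty) = 0 ∧
      (∀ b : 𝓞 K, φ.symm (ToeplitzAlgebra.u b) = FullSemigroupCStar.v ⟨b, 1⟩) ∧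
      (∀ a : (𝓞 K)⁰, φ.symm (ToeplitzAlgebra.s a) = FullSemigroupCStar.v ⟨0, a⟩) ∧
      (∀ (I : NonzeroIdeal (𝓞 K)) (X : ConstructibleIdeal (AxbSemigroup (𝓞 K))),
        X.1 = I.cosetProd 0 → φ.symm (ToeplitzAlgebra.e I) = FullSemigroupCStar.e X) := by
  refine ⟨isConstructible_axb_iff, FullSemigroupCStar.equivToeplitz (𝓞 K), ⟨?_, ?_, ?_, ?_, ?_, ?_⟩,
    ?_⟩
  · exact fun b a => FullSemigroupCStar.toToeplitz_v ⟨b, a⟩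
  · exact fun b I X hX => FullSemigroupCStar.toToeplitz_e hX
  · exact FullSemigroupCStar.toToeplitz_e_of_eq_empty (X := .empty) rfl
  · exact ToeplitzAlgebra.toFullSemigroup_u
  · exact ToeplitzAlgebra.toFullSemigroup_s
  · intro I X hX
    refine (ToeplitzAlgebra.toFullSemigroup_e I).trans ?_
    congr 1
    exact Subtype.ext hX.symm
  · rintro ψ ⟨hv, he, h0, -⟩
    -- Every constructible ideal is empty or a coset product, so the prescribed values cover all
    -- generators.
    have hψ : (ψ : _ →⋆ₐ[ℂ] ToeplitzAlgebra (𝓞 K)) = FullSemigroupCStar.toToeplitz (𝓞 K) := by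
      refine FullSemigroupCStar.hom_ext (fun p => hv p.b p.a) fun X => ?_
      rcases X.empty_or_cosetProd with hX | ⟨b, I, hX⟩
      · rw [FullSemigroupCStar.toToeplitz_e_of_eq_empty hX, ← h0]
        exact congrArg (fun Y => ψ (FullSemigroupCStar.e Y)) (Subtype.ext hX : X = .empty)
      · rw [FullSemigroupCStar.toToeplitz_e hX]
        exact he b I X hX
    exact StarAlgEquiv.ext fun x => DFunLike.congr_fun hψ x
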